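/- A \emph{cascade} is a partially ordered set $(V,\sqsubset)$ with a least element $\varnothing_V$ that is a tree (for each $v\in V$ the set of predecessors of $v$ is well ordered) and is well-founded for the inverse order (each nonempty subset has a maximal element). Write $V^+(v)$ for the set of immediate successors of $v$ and $\max V$ for the set of maximal elements. A cascade is \emph{sequential} if $V^+(v)$ is countably infinite for each $v\in V\setminus\max V$. The rank $r_V(v)$ of $v$ is the least ordinal greater than the ranks of all $w\sqsupset v$ (so it is $0$ if $v\in\max V$). A sequential cascade is \emph{monotone} if for each $v\in V\setminus\max V$ the set $V^+(v)$ can be enumerated without repetition as $(v_n)_{n<\omega}$ so that $(r_V(v_n))_n$ is non-decreasing. The \emph{standard topology} of $V$ is the finest topology in which, for each $v\in V\setminus\max V$, the cofinite filter of $V^+(v)$ converges to $v$; that is, $O\subset V$ is open if and only if $V^+(v)\setminus O$ is finite for each $v\in O$. Let $\operatorname{ext}V=\{\varnothing_V\}\cup\max V$, with the topology induced from the standard topology of $V$. A \emph{full subcascade} of a sequential cascade $V$ is a nonempty subset $U\subset V$ that is closed downwards ($v\sqsubset u\in U$ implies $v\in U$) and such that $U\cap V^+(v)$ is infinite for each $v\in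 U\setminus\max V$; with the induced order it is a sequential cascade, and $\operatorname{ext}U\subset\operatorname{ext}V$. \textbf{Theorem (continuous extension).} Let $V,W$ be monotone sequential cascades and let $\varphi:\operatorname{ext}V\to\operatorname{ext}W$ be continuous. Then there exist a full subcascade $U$ of $V$ and a map $f:U\to W$, continuous for the standard topologies of $U$ and $W$, such that $f(x)=\varphi(x)$ for each $x\in\operatorname{ext}U$. -/

import Mathlib

universe u v

/-- The set `V⁺(v)` of immediate successors of `v`. -/
def immSucc {V : Type u} [PartialOrder V] (v : V) : Set V := {w | v ⋖ w}

/-- A cascade: a tree (the predecessors of each element are well ordered) with a least element,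
well-founded for the inverse order (every nonempty subset has a maximal element). -/
structure IsCascade (V : Type u) [PartialOrder V] : Prop where
  exists_isBot : ∃ b : V, IsBot b
  isChain_Iio : ∀ v : V, IsChain (· ≤ ·) (Set.Iio v)
  isWF_Iio : ∀ v : V, (Set.Iio v).IsWF
  wellFounded_gt : WellFounded (fun a b : V => a > b)

/-- A sequential cascade: the immediate successors of each non-maximal element form a countably
infinite set. -/
structure IsSequentialCascade (V : Type u) [PartialOrder V] : Prop extends IsCascade V where
  countable_immSucc : ∀ v : V, ¬ IsMax v → (immSucc v).Countable
  infinite_immSucc : ∀ v : V, ¬ IsMax v → (immSucc v).Infinite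

/-- The rank of an element of a cascade: the least ordinal greater than the ranks of all its
(strict) successors; it is `0` for maximal elements. -/
noncomputable def IsCascade.rank {V : Type u} [PartialOrder V] (hV : IsCascade V) (v : V) :
    Ordinal.{u} :=
  @IsWellFounded.rank V (fun a b => a > b) ⟨hV.wellFounded_gt⟩ v

/-- A sequential cascade is monotone if the immediate successors of each non-maximal element can be
arranged in a sequence (of type `ω`, without repetitions) of non-decreasing ranks. -/
structure IsMonotoneSequentialCascade (V : Type u) [PartialOrder V] : Prop
    extends IsSequentialCascade V where
  exists_monotone_enum : ∀ v : V, ¬ IsMax v →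
    ∃ e : ℕ ≃ immSucc v, Monotone fun n => toIsSequentialCascade.toIsCascade.rank (e n : V)

/-- The standard topology of a (sequential) cascade: the finest topology for which, for each `v`,
the cofinite filter on the set of immediate successors of `v` converges to `v`. A set is open if
with each of its elements `v` it contains all but finitely many immediate successors of `v`. -/
@[reducible]
def standardTopology (V : Type u) [PartialOrder V] : TopologicalSpace V where
  IsOpen O := ∀ v ∈ O, (immSucc v \ O).Finite
  isOpen_univ := by simp
  isOpen_inter s t hs ht v hv := by
    rw [Set.sdiff_inter]
    exact (hs v hv.1).union (ht v hv.2)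
  isOpen_sUnion S hS v hv := by
    obtain ⟨t, ht, hvt⟩ := hv
    exact (hS t ht v hvt).subset (Set.sdiff_subset_sdiff_right (Set.subset_sUnion_of_mem ht))

/-- The set of extremal elements: the least element and the maximal elements. -/
def extremal (V : Type u) [PartialOrder V] : Set V := {v | IsBot v ∨ IsMax v}

/-- The Arens topology: the restriction of the standard topology to the extremal elements. -/
@[reducible]
def arensTopology (V : Type u) [PartialOrder V] : TopologicalSpace (extremal V) :=
  (standardTopology V).induced Subtype.val

/-- A full subcascade of a sequential cascade: a nonempty (that is, containing the least element)
closed downwards subset that, with each of its elements which is not maximal in `V`, contains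
infinitely many immediate successors of this element. -/
structure IsFullSubcascade {V : Type u} [PartialOrder V] (U : Set V) : Prop where
  nonempty : U.Nonempty
  isLowerSet : IsLowerSet U
  infinite_immSucc : ∀ v ∈ U, ¬ IsMax v → (immSucc v ∩ U).Infinite

theorem IsFullSubcascade.isMax_coe {V : Type u} [PartialOrder V] {U : Set V}
    (hU : IsFullSubcascade U) {x : U} (hx : IsMax x) : IsMax (x : V) := by
  by_contra h
  obtain ⟨w, hw, hwU⟩ := (hU.infinite_immSucc x x.2 h).nonempty
  have hlt : (x : V) < w := CovBy.lt hw
  exact absurd (hx (b := ⟨w, hwU⟩) (show (x : V) ≤ w from hlt.le)) (not_le_of_gt hlt)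

theorem IsFullSubcascade.immSucc_coe {V : Type u} [PartialOrder V] {U : Set V}
    (hU : IsFullSubcascade U) (x : U) :
    immSucc x = Subtype.val ⁻¹' (immSucc (x : V)) := by
  ext y
  constructor
  · intro h
    have h' : x ⋖ y := h
    exact ⟨h'.1, fun z hxz hzy =>
      h'.2 (c := ⟨z, hU.isLowerSet hzy.le y.2⟩) hxz hzy⟩
  · intro h
    have h' : (x : V) ⋖ y := h
    exact ⟨h'.1, fun z hxz hzy => h'.2 (c := (z : V)) hxz hzy⟩

/-- A full subcascade is itself a sequential cascade for the induced order. -/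
theorem IsFullSubcascade.isSequentialCascade {V : Type u} [PartialOrder V]
    (hV : IsSequentialCascade V) {U : Set V} (hU : IsFullSubcascade U) :
    IsSequentialCascade U where
  exists_isBot := by
    obtain ⟨b, hb⟩ := hV.exists_isBot
    obtain ⟨x, hx⟩ := hU.nonempty
    exact ⟨⟨b, hU.isLowerSet (hb x) hx⟩, fun y => hb y⟩
  isChain_Iio x a ha b hb hab :=
    hV.isChain_Iio x (show (a : V) < x from ha) (show (b : V) < x from hb)
      (fun h => hab (Subtype.ext h))
  isWF_Iio x := by
    have h := hV.isWF_Iio (x : V)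
    rw [Set.isWF_iff_no_descending_seq] at h ⊢
    intro f hf hfx
    exact h (fun n => (f n : V)) (fun m n hmn => hf hmn) (fun n => hfx n)
  wellFounded_gt := InvImage.wf (Subtype.val : U → V) hV.wellFounded_gt
  countable_immSucc x hx := by
    rw [hU.immSucc_coe]
    refine (hV.countable_immSucc x fun h => hx ?_).preimage Subtype.val_injective
    intro y hy
    exact h (b := (y : V)) hy
  infinite_immSucc x hx := by
    rw [hU.immSucc_coe]
    intro h
    refine hU.infinite_immSucc x x.2 (fun hm => hx fun y hy => hm (b := (y : V)) hy) ?_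
    have := h.image Subtype.val
    rwa [Subtype.image_preimage_coe, Set.inter_comm] at this

/-- The extremal elements of a full subcascade are extremal in the whole cascade. -/
theorem IsFullSubcascade.coe_mem_extremal {V : Type u} [PartialOrder V] (hV : IsCascade V) {U : Set V}
    (hU : IsFullSubcascade U) {x : U} (hx : x ∈ extremal U) : (x : V) ∈ extremal V := by
  rcases hx with hx | hx
  · left
    obtain ⟨b, hb⟩ := hV.exists_isBot
    have h : (x : V) ≤ b := hx ⟨b, hU.isLowerSet (hb x) x.2⟩
    exact fun y => h.trans (hb y)
  · exact Or.inr (hU.isMax_coe hx)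

/-! Call `S` large at `v` if it meets every set of the contour at `v`, the iterated limit of
cofinite filters above `v`. Continuity of `φ` at the least element says that the points sent outside
a given neighbourhood of the limit `w` are not large there. It suffices to realise `w` as an
iterated limit of values of `φ`, since the intermediate limits then define the extension on a full
subcascade (`IsIteratedLimit.exists_extension`).

`IsLarge.isIteratedLimit` finds these limits by induction from the maximal elements down, for the
contour restricted to a large set `S`. At all but finitely many successors `n` of `v` where `S` is
large, either `w` is again an iterated limit, or `φ` is largely inside the cone of some successor `a
n` of `w`. In the latter case restrict `S` to that cone and use `a n` as the value at `n`.
Exceptions are finite in number: otherwise, gluing open sets over the disjoint cones above the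
successors of `w` gives a neighbourhood of `w` that `φ` largely avoids. -/

open scoped Topology

/-! ### Order and topology of the tree -/

section Tree

variable {V : Type u} [PartialOrder V]

theorem IsCascade.le_total_of_le (hV : IsCascade V) {a b x : V} (ha : a ≤ x) (hb : b ≤ x) :
    a ≤ b ∨ b ≤ a := by
  rcases ha.eq_or_lt with rfl | ha
  · exact Or.inr hb
  rcases hb.eq_or_lt with rfl | hb
  · exact Or.inl ha.le
  exact (hV.isChain_Iio x).total ha hb

/-- Distinct immediate successors of an element have no common upper bound. -/
theorem IsCascade.immSucc_eq_of_le (hV : IsCascade V) {w a b x : V} (ha : w ⋖ a) (hb : w ⋖ b)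
    (hax : a ≤ x) (hbx : b ≤ x) : a = b := by
  rcases hV.le_total_of_le hax hbx with h | h
  · exact h.eq_of_not_lt fun h => hb.2 ha.lt h
  · exact (h.eq_of_not_lt fun h => ha.2 hb.lt h).symm

/-- An element has at most one immediate predecessor. -/
theorem IsCascade.eq_of_covBy (hV : IsCascade V) {a b x : V} (ha : a ⋖ x) (hb : b ⋖ x) :
    a = b := by
  rcases hV.le_total_of_le ha.le hb.le with h | h
  · exact h.eq_of_not_lt fun h => ha.2 h hb.lt
  · exact (h.eq_of_not_lt fun h => hb.2 h ha.lt).symm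

theorem immSucc_eq_empty_of_isMax {v : V} (hv : IsMax v) : immSucc v = ∅ :=
  Set.eq_empty_of_forall_notMem fun _ hw => hv.not_lt (CovBy.lt hw)

theorem IsSequentialCascade.countable_immSucc' (hV : IsSequentialCascade V) (v : V) :
    (immSucc v).Countable := by
  by_cases hv : IsMax v
  · simp [immSucc_eq_empty_of_isMax hv]
  · exact hV.countable_immSucc v hv

theorem isOpen_standardTopology_iff {O : Set V} :
    IsOpen[standardTopology V] O ↔ ∀ v ∈ O, (immSucc v \ O).Finite :=
  Iff.rfl

theorem isOpen_compl_singleton_standardTopology (x : V) :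
    IsOpen[standardTopology V] ({x}ᶜ : Set V) :=
  isOpen_standardTopology_iff.2 fun _ _ =>
    (Set.finite_singleton x).subset fun _ hy => not_not.1 hy.2

/-- From outside the cone above `a`, an immediate successor step can enter it only at `a` itself. -/
theorem IsCascade.isOpen_compl_Ici (hV : IsCascade V) (a : V) :
    IsOpen[standardTopology V] (Set.Ici a)ᶜ := by
  refine isOpen_standardTopology_iff.2 fun v hv => (Set.finite_singleton a).subset fun y hy => ?_
  have hay : a ≤ y := not_not.1 hy.2
  have hvy : v ⋖ y := hy.1
  by_contra hne
  have hlt : a < y := lt_of_le_of_ne hay fun h => hne h.symm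
  rcases hV.le_total_of_le hay hvy.le with h | h
  · exact hv h
  · exact hvy.2 (lt_of_le_of_ne h fun h => hv h.ge) hlt

/-- A neighbourhood of `w` obtained by gluing open sets above the immediate successors of `w`. -/
theorem isOpen_insert_iUnion_immSucc (w : V) (G : V → Set V)
    (hG : ∀ a, w ⋖ a → IsOpen[standardTopology V] (G a))
    (hfin : {a | w ⋖ a ∧ a ∉ G a}.Finite) :
    IsOpen[standardTopology V] (insert w {x | ∃ a, w ⋖ a ∧ a ≤ x ∧ x ∈ G a}) := by
  refine isOpen_standardTopology_iff.2 fun v hv => ?_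
  rcases hv with rfl | ⟨a, hwa, hav, hvG⟩
  · refine hfin.subset fun a ha => ⟨ha.1, fun haG => ha.2 (Or.inr ⟨a, ha.1, le_rfl, haG⟩)⟩
  · refine (isOpen_standardTopology_iff.1 (hG a hwa) v hvG).subset fun y hy => ⟨hy.1, fun h => ?_⟩
    exact hy.2 (Or.inr ⟨a, hwa, hav.trans (CovBy.le hy.1), h⟩)

end Tree

/-! ### Sets meshing with the contour -/

section Large

variable {V : Type u} [PartialOrder V]

/-- `IsLarge S v` says that some full subcascade of the cascade of the elements above `v` has all
its maximal elements in `S`; equivalently, `S` meets all the elements of the contour at `v`. -/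
inductive IsLarge (S : Set V) : V → Prop
  | leaf (v : V) (hv : IsMax v) (hS : v ∈ S) : IsLarge S v
  | node (v : V) (N : Set V) (hN : N ⊆ immSucc v) (hinf : N.Infinite)
      (h : ∀ n ∈ N, IsLarge S n) : IsLarge S v

theorem IsLarge.mono {S T : Set V} {v : V} (h : IsLarge S v)
    (hST : ∀ x, IsMax x → x ∈ S → x ∈ T) : IsLarge T v := by
  induction h with
  | leaf v hv hS => exact .leaf v hv (hST v hv hS)
  | node v N hN hinf _ ih => exact .node v N hN hinf ih

/-- Pigeonhole at each node: one of the two alternatives holds at infinitely many successors. -/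
theorem IsLarge.or_of_union {S T : Set V} {v : V} (h : IsLarge (S ∪ T) v) :
    IsLarge S v ∨ IsLarge T v := by
  induction h with
  | leaf v hv hS => exact hS.imp (.leaf v hv) (.leaf v hv)
  | node v N hN hinf _ ih =>
    have hunion : N ⊆ {n ∈ N | IsLarge S n} ∪ {n ∈ N | IsLarge T n} := fun n hn =>
      (ih n hn).imp (fun h => ⟨hn, h⟩) (fun h => ⟨hn, h⟩)
    rcases Set.infinite_union.1 (hinf.mono hunion) with h | h
    · exact Or.inl (.node v _ (fun n hn => hN hn.1) h fun n hn => hn.2)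
    · exact Or.inr (.node v _ (fun n hn => hN hn.1) h fun n hn => hn.2)

theorem IsLarge.diff {S T : Set V} {v : V} (h : IsLarge S v) (hT : ¬ IsLarge (S ∩ T) v) :
    IsLarge (S \ T) v := by
  rw [← Set.inter_union_sdiff S T] at h
  exact h.or_of_union.resolve_left hT

theorem IsLarge.diff_biUnion {ι : Type*} {F : Set ι} (hF : F.Finite) {S : Set V} {T : ι → Set V}
    {v : V} (h : IsLarge S v) (hT : ∀ i ∈ F, ¬ IsLarge (S ∩ T i) v) :
    IsLarge (S \ ⋃ i ∈ F, T i) v := by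
  induction F, hF using Set.Finite.induction_on with
  | empty => simpa using h
  | @insert a F _ _ ih =>
    refine ((ih fun i hi => hT i (Or.inr hi)).diff (T := T a) fun h' =>
      hT a (Or.inl rfl) (h'.mono fun x _ hx => ⟨hx.1.1, hx.2⟩)).mono fun x _ hx => ?_
    refine ⟨hx.1.1, fun h' => ?_⟩
    rw [Set.biUnion_insert] at h'
    exact h'.elim hx.2 hx.1.2

theorem IsLarge.infinite_of_not_isMax {S : Set V} {v : V} (h : IsLarge S v) (hv : ¬ IsMax v) :
    {n | v ⋖ n ∧ IsLarge S n}.Infinite := by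
  cases h with
  | leaf _ hv' _ => exact absurd hv' hv
  | node _ N hN hinf h => exact hinf.mono fun n hn => ⟨hN hn, h n hn⟩

theorem IsLarge.mem_of_isMax {S : Set V} {v : V} (h : IsLarge S v) (hv : IsMax v) : v ∈ S := by
  cases h with
  | leaf _ _ hS => exact hS
  | node _ N hN hinf h =>
    rw [immSucc_eq_empty_of_isMax hv] at hN
    exact absurd (Set.finite_empty.subset hN) hinf

/-- A witness of largeness would have a successor in `O`, and so on up to a maximal element of `O`.
-/
theorem not_isLarge_compl_of_isOpen {O : Set V} (hO : IsOpen[standardTopology V] O) {v : V}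
    (hv : v ∈ O) : ¬ IsLarge Oᶜ v := by
  intro h
  induction h with
  | leaf v _ hS => exact hS hv
  | node v N hN hinf _ ih =>
    refine hinf ((isOpen_standardTopology_iff.1 hO v hv).subset fun n hn => ⟨hN hn, fun hnO => ?_⟩)
    exact ih n hn hnO

theorem IsSequentialCascade.isLarge_univ (hV : IsSequentialCascade V) (v : V) :
    IsLarge (Set.univ : Set V) v := by
  induction v using hV.wellFounded_gt.induction with
  | _ v ih =>
    by_cases hv : IsMax v
    · exact .leaf v hv trivial
    · exact .node v _ subset_rfl (hV.infinite_immSucc v hv) fun n hn => ih n (CovBy.lt hn)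

end Large

/-! ### From convergence along contours to iterated limits -/

section Limit

variable {V : Type u} {W : Type v} [PartialOrder V] [PartialOrder W]

/-- `IsIteratedLimit φ v w` says that `w` is obtained from the values of `φ` at the maximal
elements above `v` by passing repeatedly to limits along infinite sets of immediate successors. -/
inductive IsIteratedLimit (φ : V → W) : V → W → Prop
  | leaf (v : V) (hv : IsMax v) : IsIteratedLimit φ v (φ v)
  | node (v : V) (w : W) (N : Set V) (g : V → W) (hN : N ⊆ immSucc v) (hinf : N.Infinite)
      (h : ∀ n ∈ N, IsIteratedLimit φ n (g n))
      (hlim : ∀ O, IsOpen[standardTopology W] O → w ∈ O → {n ∈ N | g n ∉ O}.Finite) :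
      IsIteratedLimit φ v w

theorem IsIteratedLimit.eq_of_isMax {φ : V → W} {v : V} {w : W} (h : IsIteratedLimit φ v w)
    (hv : IsMax v) : w = φ v := by
  cases h with
  | leaf => rfl
  | node _ _ N g hN hinf =>
    rw [immSucc_eq_empty_of_isMax hv] at hN
    exact absurd (Set.finite_empty.subset hN) hinf

theorem IsIteratedLimit.exists_of_not_isMax {φ : V → W} {v : V} {w : W}
    (h : IsIteratedLimit φ v w) (hv : ¬ IsMax v) :
    ∃ (N : Set V) (g : V → W), N ⊆ immSucc v ∧ N.Infinite ∧
      (∀ n ∈ N, IsIteratedLimit φ n (g n)) ∧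
      ∀ O, IsOpen[standardTopology W] O → w ∈ O → {n ∈ N | g n ∉ O}.Finite := by
  cases h with
  | leaf _ hv' => exact absurd hv' hv
  | node _ _ N g hN hinf h hlim => exact ⟨N, g, hN, hinf, h, hlim⟩

/-- If `φ` tends to `w` along the trace on `S` of the contour at `v`, then there cannot be
infinitely many `n` above which `φ` is large away from the immediate successor `a n` of `w`, while
being large inside the cascade above `a n`. -/
theorem IsCascade.finite_of_not_tendsto (hW : IsCascade W) {φ : V → W} {v : V} {w : W} {S : Set V}
    (hS : ∀ O, IsOpen[standardTopology W] O → w ∈ O → ¬ IsLarge (S ∩ φ ⁻¹' Oᶜ) v)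
    {N : Set V} (hN : N ⊆ immSucc v) (a : V → W) (ha : ∀ n ∈ N, w ⋖ a n)
    (hafin : ∀ b, {n ∈ N | a n = b}.Finite) (O : V → Set W)
    (hO : ∀ n ∈ N, IsOpen[standardTopology W] (O n)) (haO : ∀ n ∈ N, a n ∈ O n)
    (hlarge : ∀ n ∈ N, IsLarge (S ∩ φ ⁻¹' Set.Ici (a n) ∩ φ ⁻¹' (O n)ᶜ) n) : N.Finite := by
  by_contra hinf
  -- Above each successor `b` only finitely many conditions `O n` compete, so all can be imposed at
  -- once.
  let G : W → Set W := fun b => ⋂ n ∈ {n ∈ N | a n = b}, O n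
  have hG : ∀ b, w ⋖ b → IsOpen[standardTopology W] (G b) := fun b _ =>
    @Set.Finite.isOpen_biInter _ _ (standardTopology W) _ _ (hafin b) fun n hn => hO n hn.1
  have hfin : {b | w ⋖ b ∧ b ∉ G b}.Finite := by
    refine Set.finite_empty.subset fun b hb => hb.2 (Set.mem_iInter₂.2 fun n hn => ?_)
    exact hn.2 ▸ haO n hn.1
  refine hS _ (isOpen_insert_iUnion_immSucc w G hG hfin) (Set.mem_insert _ _)
    (.node v N hN hinf fun n hn => (hlarge n hn).mono fun x _ hx => ⟨hx.1.1, ?_⟩)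
  have hax : a n ≤ φ x := hx.1.2
  rintro (h | ⟨b, hwb, hbx, hb⟩)
  · exact absurd (h ▸ hax) (ha n hn).lt.not_ge
  · exact hx.2 (Set.mem_iInter₂.1 hb n ⟨hn, hW.immSucc_eq_of_le (ha n hn) hwb hax hbx⟩)

/-- If `φ` tends to `w` along the trace on `S` of the contour at `v`, then there cannot be
infinitely many `n` above which `φ` is large away from `w`, without being large in the
cascade above any immediate successor of `w`. -/
theorem IsSequentialCascade.finite_of_not_tendsto (hV : IsSequentialCascade V)
    (hW : IsSequentialCascade W) {φ : V → W} {v : V} {w : W} {S : Set V}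
    (hS : ∀ O, IsOpen[standardTopology W] O → w ∈ O → ¬ IsLarge (S ∩ φ ⁻¹' Oᶜ) v)
    {N : Set V} (hN : N ⊆ immSucc v) (O : V → Set W)
    (hO : ∀ n ∈ N, IsOpen[standardTopology W] (O n)) (hwO : ∀ n ∈ N, w ∈ O n)
    (hlarge : ∀ n ∈ N, IsLarge (S ∩ φ ⁻¹' (O n)ᶜ) n)
    (hsmall : ∀ n ∈ N, ∀ a, w ⋖ a → ¬ IsLarge (S ∩ φ ⁻¹' Set.Ici a) n) : N.Finite := by
  by_contra hinf
  obtain ⟨e, he⟩ := Set.countable_iff_exists_injOn.1 (hW.countable_immSucc' w)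
  obtain ⟨i, hi⟩ := Set.countable_iff_exists_injOn.1 ((hV.countable_immSucc' v).mono hN)
  -- Diagonal choice: `F n` is finite, while a given `a` escapes `F n` only if `i n < e a`, hence
  -- for finitely many `n`.
  let F : V → Set W := fun n => {a | w ⋖ a ∧ (a ∉ O n ∨ e a ≤ i n)}
  have hF : ∀ n ∈ N, (F n).Finite := fun n hn => by
    have h1 : {a | w ⋖ a ∧ a ∉ O n}.Finite :=
      isOpen_standardTopology_iff.1 (hO n hn) w (hwO n hn)
    have h2 : {a | w ⋖ a ∧ e a ≤ i n}.Finite :=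
      Set.Finite.of_finite_image ((Set.finite_Iic (i n)).subset
        (Set.image_subset_iff.2 fun a ha => ha.2)) (he.mono fun a ha => ha.1)
    refine (h1.union h2).subset fun a ha => ha.2.imp (fun h => ⟨ha.1, h⟩) fun h => ⟨ha.1, h⟩
  let G : W → Set W := fun a => ⋂ n ∈ {n ∈ N | a ∉ F n}, O n
  have hG : ∀ a, w ⋖ a → IsOpen[standardTopology W] (G a) := fun a ha => by
    refine @Set.Finite.isOpen_biInter _ _ (standardTopology W) _ _ ?_ fun n hn => hO n hn.1
    refine Set.Finite.of_finite_image ((Set.finite_Iio (e a)).subset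
      (Set.image_subset_iff.2 fun n hn => ?_)) (hi.mono fun n hn => hn.1)
    exact lt_of_not_ge fun h => hn.2 ⟨ha, Or.inr h⟩
  have hfin : {a | w ⋖ a ∧ a ∉ G a}.Finite := by
    refine Set.finite_empty.subset fun a ha => ha.2 (Set.mem_iInter₂.2 fun n hn => ?_)
    by_contra h
    exact hn.2 ⟨ha.1, Or.inl h⟩
  refine hS _ (isOpen_insert_iUnion_immSucc w G hG hfin) (Set.mem_insert _ _)
    (.node v N hN hinf fun n hn => ?_)
  -- No single cone is large at `n`, so removing the finitely many cones over `F n` preserves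
  -- largeness; on the other cones the glued set lies in `O n`.
  refine ((hlarge n hn).diff_biUnion (hF n hn) (T := fun a => φ ⁻¹' Set.Ici a) fun a ha h =>
    hsmall n hn a ha.1 (h.mono fun x _ hx => ⟨hx.1.1, hx.2⟩)).mono fun x _ hx => ⟨hx.1.1, ?_⟩
  rintro (h | ⟨a, hwa, hax, hxG⟩)
  · exact hx.1.2 (h ▸ hwO n hn)
  · refine hx.1.2 (Set.mem_iInter₂.1 hxG n ⟨hn, fun haF => hx.2 ?_⟩)
    exact Set.mem_iUnion₂.2 ⟨a, haF, hax⟩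

/-- If `φ` tends to `w` along the trace on `S` of the contour at `v`, then `w` is an iterated limit
of `φ` at `v`. -/
theorem IsLarge.isIteratedLimit (hV : IsSequentialCascade V) (hW : IsSequentialCascade W)
    (φ : V → W) (v : V) : ∀ (w : W) (S : Set V), IsLarge S v →
      (∀ O, IsOpen[standardTopology W] O → w ∈ O → ¬ IsLarge (S ∩ φ ⁻¹' Oᶜ) v) →
      IsIteratedLimit φ v w := by
  induction v using hV.wellFounded_gt.induction with
  | _ v ih =>
  intro w S hlarge hS
  by_cases hv : IsMax v
  · have hw : w = φ v := by
      by_contra hne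
      refine hS _ (isOpen_compl_singleton_standardTopology (φ v)) hne (.leaf v hv ?_)
      exact ⟨hlarge.mem_of_isMax hv, fun h => h rfl⟩
    exact hw ▸ .leaf v hv
  have hM := hlarge.infinite_of_not_isMax hv
  -- If `w` is a limit at infinitely many successors, the constant value `w` works.
  by_cases h₁ : {n | v ⋖ n ∧ IsIteratedLimit φ n w}.Infinite
  · refine .node v w _ (fun _ => w) (fun n hn => hn.1) h₁ (fun n hn => hn.2) fun O _ hw => ?_
    exact Set.finite_empty.subset fun n hn => hn.2 hw
  let N₂ : Set V := {n | v ⋖ n ∧ ∃ a, w ⋖ a ∧ IsLarge (S ∩ φ ⁻¹' Set.Ici a) n}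
  have h₃ : {n | (v ⋖ n ∧ IsLarge S n) ∧ ¬ IsIteratedLimit φ n w ∧ n ∉ N₂}.Finite := by
    have key : ∀ n, (v ⋖ n ∧ IsLarge S n) ∧ ¬ IsIteratedLimit φ n w ∧ n ∉ N₂ →
        ∃ O, IsOpen[standardTopology W] O ∧ w ∈ O ∧ IsLarge (S ∩ φ ⁻¹' Oᶜ) n := by
      rintro n ⟨⟨hvn, hn⟩, hlim, -⟩
      by_contra! hcon
      exact hlim (ih n hvn.lt w S hn hcon)
    choose! O hO hwO hOl using key
    refine hV.finite_of_not_tendsto hW hS (fun n hn => hn.1.1) O hO hwO hOl ?_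
    exact fun n hn a ha h => hn.2.2 ⟨hn.1.1, a, ha, h⟩
  have h₂ : N₂.Infinite := by
    intro h
    refine hM (((Set.not_infinite.1 h₁).union (h₃.union h)).subset fun n hn => ?_)
    by_cases hl : IsIteratedLimit φ n w
    · exact Or.inl ⟨hn.1, hl⟩
    by_cases hn₂ : n ∈ N₂
    · exact Or.inr (Or.inr hn₂)
    · exact Or.inr (Or.inl ⟨hn, hl, hn₂⟩)
  have hN₂ : ∀ n ∈ N₂, ∃ a, w ⋖ a ∧ IsLarge (S ∩ φ ⁻¹' Set.Ici a) n := fun n hn => hn.2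
  have : Nonempty W := ⟨w⟩
  choose! a ha hal using hN₂
  -- An infinite fibre would make the cone above `b` large at `v`, but its complement is a
  -- neighbourhood of `w`.
  have hafin : ∀ b, {n ∈ N₂ | a n = b}.Finite := fun b => by
    by_contra hinf
    obtain ⟨m, hm, hmb⟩ := Set.Infinite.nonempty hinf
    subst hmb
    have hwb : w ⋖ a m := ha m hm
    refine hS _ (hW.isOpen_compl_Ici (a m)) hwb.lt.not_ge
      (.node v _ (fun n hn => hn.1.1) hinf fun n hn => (hal n hn.1).mono fun x _ hx => ⟨hx.1, ?_⟩)
    exact fun h => h (hn.2 ▸ hx.2)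
  have hbad : {n ∈ N₂ | ¬ IsIteratedLimit φ n (a n)}.Finite := by
    have key : ∀ n ∈ {n ∈ N₂ | ¬ IsIteratedLimit φ n (a n)}, ∃ O, IsOpen[standardTopology W] O ∧
        a n ∈ O ∧ IsLarge (S ∩ φ ⁻¹' Set.Ici (a n) ∩ φ ⁻¹' Oᶜ) n := by
      rintro n ⟨hn, hlim⟩
      by_contra! hcon
      exact hlim (ih n hn.1.lt (a n) _ (hal n hn) hcon)
    choose! O hO haO hOl using key
    exact hW.toIsCascade.finite_of_not_tendsto hS (fun n hn => hn.1.1) a (fun n hn => ha n hn.1)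
      (fun b => (hafin b).subset fun n hn => ⟨hn.1.1, hn.2⟩) O hO haO hOl
  refine .node v w (N₂ \ {n ∈ N₂ | ¬ IsIteratedLimit φ n (a n)}) a (fun n hn => hn.1.1)
    (h₂.sdiff hbad) (fun n hn => ?_) fun O hO hw => ?_
  · by_contra h
    exact hn.2 ⟨hn.1, h⟩
  -- The values `a n` tend to `w`: `O` omits finitely many successors of `w`, each with a finite
  -- fibre.
  · refine ((isOpen_standardTopology_iff.1 hO w hw).biUnion fun b _ => hafin b).subset
      fun n hn => Set.mem_iUnion₂.2 ⟨a n, ⟨ha n hn.1.1, hn.2⟩, hn.1.1, rfl⟩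

end Limit

/-! ### Building the extension from an iterated limit -/

section Extension

variable {V : Type u} {W : Type v} [PartialOrder V]

/-- The graph of the map built downwards from the value `w₀` at `r`: when `v` has the value `w`,
the immediate successors `n ∈ N v w` of `v` have the values `g v w n`. -/
inductive TreeGraph (N : V → W → Set V) (g : V → W → V → W) (r : V) (w₀ : W) : V → W → Prop
  | root : TreeGraph N g r w₀ r w₀
  | succ (v : V) (w : W) (n : V) (h : TreeGraph N g r w₀ v w) (hvn : v ⋖ n) (hn : n ∈ N v w) :
      TreeGraph N g r w₀ n (g v w n)

namespace TreeGraph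

variable {N : V → W → Set V} {g : V → W → V → W} {r : V} {w₀ : W}

theorem unique (hV : IsCascade V) (hr : IsBot r) {v : V} {w : W}
    (h : TreeGraph N g r w₀ v w) : ∀ w', TreeGraph N g r w₀ v w' → w' = w := by
  induction h with
  | root =>
    intro w' h'
    cases h' with
    | root => rfl
    | succ u _ _ _ hur _ => exact absurd (hr u) hur.lt.not_ge
  | succ v w n h hvn hn ih =>
    intro w' h'
    cases h' with
    | root => exact absurd (hr v) hvn.lt.not_ge
    | succ u w'' _ h'' hun _ =>
      obtain rfl := hV.eq_of_covBy hvn hun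
      rw [ih _ h'']

theorem of_succ (hV : IsCascade V) (hr : IsBot r) {v n : V} {w w' : W}
    (hv : TreeGraph N g r w₀ v w) (hvn : v ⋖ n) (hn : TreeGraph N g r w₀ n w') :
    n ∈ N v w ∧ w' = g v w n := by
  cases hn with
  | root => exact absurd (hr v) hvn.lt.not_ge
  | succ u w'' _ h'' hun hN =>
    obtain rfl := hV.eq_of_covBy hvn hun
    obtain rfl := hv.unique hV hr _ h''
    exact ⟨hN, rfl⟩

theorem exists_of_le (hV : IsCascade V) (hr : IsBot r) {v : V} {w : W}
    (h : TreeGraph N g r w₀ v w) : ∀ u ≤ v, ∃ w', TreeGraph N g r w₀ u w' := by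
  induction h with
  | root => exact fun u hu => ⟨w₀, le_antisymm hu (hr u) ▸ .root⟩
  | succ v w n h hvn hn ih =>
    intro u hu
    rcases hu.eq_or_lt with rfl | hlt
    · exact ⟨_, .succ v w u h hvn hn⟩
    · refine ih u ?_
      rcases hV.le_total_of_le hu hvn.le with huv | hvu
      · exact huv
      · exact (hvu.eq_of_not_lt fun h => hvn.2 h hlt).ge

end TreeGraph

variable [PartialOrder W]

/-- An iterated limit at the least element is the value of a continuous extension of `φ` to a full
subcascade. -/
theorem IsIteratedLimit.exists_extension (hV : IsSequentialCascade V) {φ : V → W} {r : V}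
    (hr : IsBot r) {w₀ : W} (h₀ : IsIteratedLimit φ r w₀) :
    ∃ (U : Set V) (_ : IsFullSubcascade U) (f : U → W),
      @Continuous _ _ (standardTopology U) (standardTopology W) f ∧
      (∀ x : U, (x : V) = r → f x = w₀) ∧ ∀ x : U, IsMax (x : V) → f x = φ x := by
  have key : ∀ v w, IsIteratedLimit φ v w ∧ ¬ IsMax v → ∃ (N : Set V) (g : V → W),
      N ⊆ immSucc v ∧ N.Infinite ∧ (∀ n ∈ N, IsIteratedLimit φ n (g n)) ∧
      ∀ O, IsOpen[standardTopology W] O → w ∈ O → {n ∈ N | g n ∉ O}.Finite :=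
    fun v w h => h.1.exists_of_not_isMax h.2
  have : Nonempty W := ⟨w₀⟩
  choose! N g hN hinf hg hlim using key
  have hgood : ∀ v w, TreeGraph N g r w₀ v w → IsIteratedLimit φ v w := by
    intro v w h
    induction h with
    | root => exact h₀
    | succ v w n _ hvn hn ih => exact hg v w ⟨ih, fun hv => hv.not_lt hvn.lt⟩ n hn
  let U : Set V := {v | ∃ w, TreeGraph N g r w₀ v w}
  have hU : IsFullSubcascade U := by
    refine ⟨⟨r, w₀, .root⟩, fun v u huv hv => ?_, fun v hv hmax => ?_⟩
    · obtain ⟨w, hw⟩ := hv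
      exact hw.exists_of_le hV.toIsCascade hr u huv
    · obtain ⟨w, hw⟩ := hv
      have hvw := And.intro (hgood v w hw) hmax
      exact (hinf v w hvw).mono fun n hn =>
        ⟨hN v w hvw hn, _, .succ v w n hw (hN v w hvw hn) hn⟩
  choose f hf using fun x : U => x.2
  refine ⟨U, hU, f, ?_, fun x hx => ?_, fun x hx => (hgood _ _ (hf x)).eq_of_isMax hx⟩
  · refine @Continuous.mk _ _ (standardTopology U) (standardTopology W) _ fun O hO => ?_
    refine isOpen_standardTopology_iff.2 fun x hx => ?_
    rw [hU.immSucc_coe]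
    by_cases hmax : IsMax (x : V)
    · simp [immSucc_eq_empty_of_isMax hmax]
    · refine Set.Finite.of_finite_image
        ((hlim x (f x) ⟨hgood _ _ (hf x), hmax⟩ O hO hx).subset ?_)
        Subtype.val_injective.injOn
      rintro _ ⟨y, ⟨hxy, hyO⟩, rfl⟩
      obtain ⟨hyN, hfy⟩ := (hf x).of_succ hV.toIsCascade hr hxy (hf y)
      exact ⟨hyN, fun h => hyO (show f y ∈ O from hfy ▸ h)⟩
  · exact (TreeGraph.root (N := N) (g := g)).unique hV.toIsCascade hr _ (hx ▸ hf x)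

end Extension

theorem mainTheorem1 {V : Type u} {W : Type v} [PartialOrder V] [PartialOrder W]
    (hV : IsMonotoneSequentialCascade V) (hW : IsMonotoneSequentialCascade W)
    (φ : extremal V → extremal W) (hφ : @Continuous _ _ (arensTopology V) (arensTopology W) φ) :
    ∃ (U : Set V) (hU : IsFullSubcascade U) (f : U → W),
      @Continuous _ _ (standardTopology U) (standardTopology W) f ∧
      ∀ (x : U) (hx : x ∈ extremal U), f x = (φ ⟨x, hU.coe_mem_extremal hV.toIsCascade hx⟩ : W) := by
  classical
  obtain ⟨r, hr⟩ := hV.exists_isBot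
  have hrext : r ∈ extremal V := Or.inl hr
  -- The value off the extremal elements is arbitrary: largeness and iterated limits see only
  -- maximal elements.
  let ψ : V → W := fun x => if h : x ∈ extremal V then φ ⟨x, h⟩ else φ ⟨r, hrext⟩
  have hψ : ∀ x (h : x ∈ extremal V), ψ x = φ ⟨x, h⟩ := fun x h => dif_pos h
  have hlim : IsIteratedLimit ψ r (ψ r) := by
    refine IsLarge.isIteratedLimit hV.toIsSequentialCascade hW.toIsSequentialCascade ψ r (ψ r) _
      (hV.toIsSequentialCascade.isLarge_univ r) fun O hO hwO hlarge => ?_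
    have hpre : IsOpen[arensTopology W] (Subtype.val ⁻¹' O) := ⟨O, hO, rfl⟩
    obtain ⟨O', hO', hO'eq⟩ :=
      @Continuous.isOpen_preimage _ _ (arensTopology V) (arensTopology W) φ hφ _ hpre
    have hmem : ∀ x (h : x ∈ extremal V), x ∈ O' ↔ ψ x ∈ O := fun x h => by
      rw [hψ x h]
      exact Set.ext_iff.1 hO'eq ⟨x, h⟩
    refine not_isLarge_compl_of_isOpen hO' ((hmem r hrext).2 hwO) (hlarge.mono fun x hx hxO => ?_)
    exact fun h => hxO.2 ((hmem x (Or.inr hx)).1 h)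
  obtain ⟨U, hU, f, hf, hroot, hmax⟩ := hlim.exists_extension hV.toIsSequentialCascade hr
  refine ⟨U, hU, f, hf, fun x hx => ?_⟩
  rw [← hψ]
  rcases hx with hx | hx
  · have hxr : (x : V) = r :=
      le_antisymm (hx ⟨r, hU.isLowerSet (hr x) x.2⟩) (hr x)
    rw [hroot x hxr, hxr]
  · exact hmax x (hU.isMax_coe hx)
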